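/- **Theorem 3.1 (Relative matrix-tree theorem).** All simplicial complexes are finite abstract complexes on a totally ordered vertex set and contain the empty face, of dimension $-1$. Let $A$ be a subcomplex of a simplicial complex $X$. Write $X_k$ for the set of $k$-dimensional faces, $X_{(k)}$ for the $k$-skeleton, and $f_k(X,A)=|X_k\setminus A_k|$. Let $C_k(X,A;R)$ be the free $R$-module on $X_k\setminus A_k$, with relative boundary map $\partial_k(X,A;R)[\sigma]=\sum_{\eta\in X_{k-1}\setminus A_{k-1},\,\eta\subseteq\sigma}\operatorname{sgn}([\eta],[\sigma])[\eta]$, where $\operatorname{sgn}([\eta],[\sigma])=(-1)^i$ if $\sigma=\{v_0<\dots<v_k\}$ and $\eta=\sigma\setminus\{v_i\}$. Put $H_k(X,A)=\ker\partial_k(X,A;\mathbb Z)/\operatorname{im}\partial_{k+1}(X,A;\mathbb Z)$, let $\beta_k(X,A)$ be its rank, and let $L^{\mathrm{ud}}_{k}(X,A)=\partial_{k+1}(X,A;\mathbb R)\,\partial_{k+1}(X,A;\mathbb R)^{*}$. Chain groups in dimensions below $0$ vanish, and the $p$-skeleton for $p\le -1$ is $\{\emptyset\}$. For $-1\le k\le\dim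 X$, a *$k$-dimensional relative spanning forest* of $(X,A)$ is a complex $\Upsilon$ with $A_{(k)}\subseteq\Upsilon\subseteq X_{(k)}$ and $\Upsilon_{(k-1)}=X_{(k-1)}$ such that (a) $\beta_k(\Upsilon,A_{(k)})=0$, (b) $\beta_{k-1}(\Upsilon,A_{(k)})=\beta_{k-1}(X,A)$, and (c) $f_k(\Upsilon,A_{(k)})=f_k(X,A)-\beta_k(X_{(k)},A_{(k)})$. It is a *relative spanning tree* if instead of (b) one has (b$^*$) $\beta_{k-1}(\Upsilon,A_{(k)})=0$ (with (a) and (c)). Let $\mathcal F_k(X,A)$ and $\mathcal T_k(X,A)$ be the sets of $k$-dimensional relative spanning forests and trees. For a finitely generated abelian group $H$ of rank $\beta$, $H/\mathbb Z^{\beta}$ denotes the quotient of $H$ by a direct summand isomorphic to $\mathbb Z^\beta$ (a finite group, whose order does not depend on the summand). Let $0\le k\le \dim X$. Then $\mathcal F_k(X,A)\ne\emptyset$ and $\mathcal T_k(X,A)\subseteq\mathcal F_k(X,A)$. Moreover, $\mathcal T_k(X,A)\neq\emptyset$ if and only if $\beta_{k-1}(X,A)=0$. In this case, with $\beta=\beta_{k-2}(X,A)$: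 (i) The product of all nonzero eigenvalues (with multiplicity) of $L^{\mathrm{ud}}_{k-1}(X,A)$ equals $$\sum_{\Upsilon\in\mathcal T_k(X,A)}|H_{k-1}(\Upsilon,A_{(k)})|^2\cdot\sum_{\Gamma\in\mathcal F_{k-1}(X,A)}\frac{|H_{k-2}(\Gamma,A_{(k-1)})/\mathbb Z^\beta|^2}{|H_{k-2}(X,A)/\mathbb Z^\beta|^2}.$$ (ii) For every $\Gamma\in\mathcal F_{k-1}(X,A)$, $$\sum_{\Upsilon\in\mathcal T_k(X,A)}|H_{k-1}(\Upsilon,A_{(k)})|^2=\frac{|H_{k-2}(X,A)/\mathbb Z^\beta|^2}{|H_{k-2}(\Gamma,A_{(k-1)})/\mathbb Z^\beta|^2}\,\det L^{\mathrm{ud}}_{k-1}(X,\Gamma).$$ Empty products and determinants of empty matrices are $1$. -/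

import Mathlib

namespace RelTree

/-- A finite (abstract) simplicial complex with vertices in `V`: a finite collection of finite
sets that is closed under inclusion. The empty set is always a face (of dimension `-1`). -/
@[ext]
structure Cx (V : Type*) where
  faces : Finset (Finset V)
  empty_mem : ∅ ∈ faces
  down_closed : ∀ σ ∈ faces, ∀ τ, τ ⊆ σ → τ ∈ faces

variable {V : Type*}

/-- The dimension of a complex: the maximum of `|σ| - 1` over its faces `σ`. -/
def dim (X : Cx V) : ℤ := ((X.faces.sup Finset.card : ℕ) : ℤ) - 1

/-- The `p`-skeleton, consisting of the faces of dimension at most `p`. (For `p ≥ -1` the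
alternative `σ = ∅` is redundant; for `p < -1` the skeleton is the complex `{∅}`.) -/
def skeleton [DecidableEq V] (X : Cx V) (p : ℤ) : Cx V where
  faces := X.faces.filter fun σ => (σ.card : ℤ) ≤ p + 1 ∨ σ = ∅
  empty_mem := by simp [X.empty_mem]
  down_closed := by
    intro σ hσ τ hτ
    rw [Finset.mem_filter] at hσ ⊢
    refine ⟨X.down_closed σ hσ.1 τ hτ, ?_⟩
    rcases hσ.2 with h | h
    · left
      have := Finset.card_le_card hτ
      omega
    · right
      subst h
      exact Finset.subset_empty.mp hτ

section LinearOrder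

variable [LinearOrder V]

/-- `X_k ∖ A_k`, the `k`-dimensional faces of `X` that are not faces of `A`. -/
def relFaces (X A : Cx V) (k : ℤ) : Finset (Finset V) :=
  (X.faces \ A.faces).filter fun σ => (σ.card : ℤ) = k + 1

/-- `f_k(X,A) = |X_k ∖ A_k|`. -/
def fNum (X A : Cx V) (k : ℤ) : ℕ := (relFaces X A k).card

/-- The incidence number of the faces `η` and `σ`, both oriented by the order of `V`:
it is `(-1)^i` if `σ = {v_0 < ⋯ < v_m}` and `η = σ ∖ {v_i}`, and `0` if `η` is not of this form. -/
def incidence (η σ : Finset V) : ℤ :=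
  ∑ v ∈ σ, if σ.erase v = η then (-1) ^ (σ.filter (· < v)).card else 0

/-- The relative chain module `C_k(X,A;R)`, free on `X_k ∖ A_k`. -/
abbrev Chain (R : Type*) (X A : Cx V) (k : ℤ) : Type _ := relFaces X A k → R

/-- The matrix of incidence numbers with rows `X_i ∖ A_i` and columns `X_j ∖ A_j`.
For `i = j - 1` it is the matrix of the relative boundary map `∂_j(X,A;R)`. -/
def boundaryMatrix (R : Type*) [CommRing R] (X A : Cx V) (i j : ℤ) :
    Matrix (relFaces X A i) (relFaces X A j) R :=
  Matrix.of fun η σ => ((incidence η.1 σ.1 : ℤ) : R)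

/-- For `i = j - 1`, the relative boundary map `∂_j(X,A;R) : C_j(X,A;R) → C_{j-1}(X,A;R)`. -/
def boundary (R : Type*) [CommRing R] (X A : Cx V) (i j : ℤ) :
    Chain R X A j →ₗ[R] Chain R X A i :=
  (boundaryMatrix R X A i j).mulVecLin

/-- The relative homology `H_k(X,A;R) = ker ∂_k / im ∂_{k+1}`. -/
abbrev Homology (R : Type*) [CommRing R] (X A : Cx V) (k : ℤ) : Type _ :=
  LinearMap.ker (boundary R X A (k - 1) k) ⧸
    (LinearMap.range (boundary R X A k (k + 1))).submoduleOf
      (LinearMap.ker (boundary R X A (k - 1) k))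

/-- The relative Betti number `β_k(X,A)`, the rank of `H_k(X,A;ℤ)`. -/
noncomputable def betti (X A : Cx V) (k : ℤ) : ℕ := Module.finrank ℤ (Homology ℤ X A k)

/-- The up-down Laplacian `L^{ud}_k(X,A) = ∂_{k+1} ∂_{k+1}^*` over `ℝ`, as a matrix in the basis
`X_k ∖ A_k`. -/
noncomputable def upDownLaplacian (X A : Cx V) (k : ℤ) :
    Matrix (relFaces X A k) (relFaces X A k) ℝ :=
  boundaryMatrix ℝ X A k (k + 1) * (boundaryMatrix ℝ X A k (k + 1)).transpose

/-- The conditions common to forests and trees: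
`A_(k) ⊆ Y ⊆ X_(k)`, `Y_(k-1) = X_(k-1)`, `β_k(Y,A_(k)) = 0` and
`f_k(Y,A_(k)) = f_k(X,A) - β_k(X_(k),A_(k))`. -/
structure IsSpanning (X A : Cx V) (k : ℤ) (Y : Cx V) : Prop where
  le : (skeleton A k).faces ⊆ Y.faces
  ge : Y.faces ⊆ (skeleton X k).faces
  skeleton_eq : skeleton Y (k - 1) = skeleton X (k - 1)
  betti_top : betti Y (skeleton A k) k = 0
  fNum_eq : (fNum Y (skeleton A k) k : ℤ) =
    (fNum X A k : ℤ) - (betti (skeleton X k) (skeleton A k) k : ℤ)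

/-- The set `𝓕_k(X,A)` of `k`-dimensional relative spanning forests of `(X,A)`. -/
def forests (X A : Cx V) (k : ℤ) : Set (Cx V) :=
  {Y | IsSpanning X A k Y ∧ betti Y (skeleton A k) (k - 1) = betti X A (k - 1)}

/-- The set `𝓣_k(X,A)` of `k`-dimensional relative spanning trees of `(X,A)`. -/
def trees (X A : Cx V) (k : ℤ) : Set (Cx V) :=
  {Y | IsSpanning X A k Y ∧ betti Y (skeleton A k) (k - 1) = 0}

end LinearOrder

/-- The product, with multiplicities, of the nonzero (real) eigenvalues of a matrix. -/
noncomputable def nonzeroEigenvalueProd {n : Type*} [Fintype n] [DecidableEq n]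
    (M : Matrix n n ℝ) : ℝ :=
  (M.charpoly.roots.filter (· ≠ 0)).prod

/-- `F` is a direct summand of the `R`-module `H` that is isomorphic to `R^r`. -/
def IsFreeSummand (R H : Type*) [CommRing R] [AddCommGroup H] [Module R H] (r : ℕ)
    (F : Submodule R H) : Prop :=
  Nonempty (F ≃ₗ[R] (Fin r → R)) ∧ ∃ T : Submodule R H, IsCompl F T

section FreeSummand

variable {R H : Type*} [CommRing R] [IsDomain R] [IsPrincipalIdealRing R]
  [AddCommGroup H] [Module R H] [Module.Finite R H]

lemma exists_isFreeSummand :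
    ∃ F : Submodule R H, IsFreeSummand R H (Module.finrank R H) F := by
  let q := (Submodule.torsion R H).mkQ
  obtain ⟨s, hs⟩ := Module.projective_lifting_property q LinearMap.id
    (Submodule.mkQ_surjective _)
  have hs' : ∀ x, q (s x) = x := fun x => LinearMap.congr_fun hs x
  have hinj : Function.Injective s := Function.LeftInverse.injective hs'
  have hrank : Module.finrank R (H ⧸ Submodule.torsion R H) = Module.finrank R H := by
    have h1 := Submodule.finrank_quotient_add_finrank (Submodule.torsion R H)
    have h2 : Module.finrank R (Submodule.torsion R H) = 0 :=
      Module.finrank_eq_zero_iff_isTorsion.mpr Submodule.torsion_isTorsion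
    omega
  refine ⟨LinearMap.range s, ⟨?_⟩, LinearMap.ker q, ?_, ?_⟩
  · exact (LinearEquiv.ofInjective s hinj).symm.trans
      (Module.finBasisOfFinrankEq R _ hrank).equivFun
  · rw [Submodule.disjoint_def]
    rintro _ ⟨y, rfl⟩ hy
    rw [LinearMap.mem_ker, hs'] at hy
    rw [hy, map_zero]
  · rw [codisjoint_iff, eq_top_iff]
    intro x _
    rw [Submodule.mem_sup]
    refine ⟨s (q x), ⟨_, rfl⟩, x - s (q x), ?_, by abel⟩
    rw [LinearMap.mem_ker, map_sub, hs', sub_self]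

lemma card_quotient_of_isFreeSummand {F : Submodule R H}
    (hF : IsFreeSummand R H (Module.finrank R H) F) :
    Nat.card (H ⧸ F) = Nat.card (Submodule.torsion R H) := by
  obtain ⟨⟨e⟩, T, hT⟩ := hF
  have hFfree : Module.Free R F := Module.Free.of_equiv e.symm
  have hFr : Module.finrank R F = Module.finrank R H := by
    rw [e.finrank_eq, Module.finrank_fin_fun]
  let g := Submodule.quotientEquivOfIsCompl F T hT
  have hT0 : Module.finrank R T = 0 := by
    have h1 := Submodule.finrank_quotient_add_finrank F
    rw [g.finrank_eq] at h1
    omega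
  have hTt : Module.IsTorsion R T := Module.finrank_eq_zero_iff_isTorsion.mp hT0
  have hTe : T = Submodule.torsion R H := by
    apply le_antisymm
    · intro x hx
      obtain ⟨a, ha⟩ := @hTt ⟨x, hx⟩
      exact ⟨a, by exact congrArg Subtype.val ha⟩
    · rintro x ⟨a, ha⟩
      have hx : x ∈ F ⊔ T := by rw [hT.sup_eq_top]; trivial
      obtain ⟨y, hy, z, hz, rfl⟩ := Submodule.mem_sup.mp hx
      have ha' : (a : R) • y + (a : R) • z = 0 := (smul_add (a : R) y z).symm.trans ha
      have hy0 : (a : R) • y = 0 := by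
        refine Submodule.disjoint_def.mp hT.disjoint _ (F.smul_mem _ hy) ?_
        rw [eq_neg_of_add_eq_zero_left ha']
        exact T.neg_mem (T.smul_mem _ hz)
      have h1 : (a : R) • e ⟨y, hy⟩ = 0 := by
        rw [← map_smul]
        have : (a : R) • (⟨y, hy⟩ : F) = 0 := Subtype.ext hy0
        rw [this, map_zero]
      have ha0 : (a : R) ≠ 0 := nonZeroDivisors.coe_ne_zero a
      have h2 : e ⟨y, hy⟩ = 0 := (smul_eq_zero.mp h1).resolve_left ha0
      have h3 : (⟨y, hy⟩ : F) = 0 := e.map_eq_zero_iff.mp h2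
      have h4 : y = 0 := congrArg Subtype.val h3
      rw [h4, zero_add]
      exact hz
  rw [Nat.card_congr g.toEquiv, hTe]

end FreeSummand

open Classical in
/-- The order `|H / ℤ^r|` of the quotient of the finitely generated abelian group `H` of rank `r`
by a direct summand isomorphic to `ℤ^r`. Such a summand exists, and the order does not depend on
its choice: see `exists_isFreeSummand` and `freeQuotientCard_eq`. -/
noncomputable def freeQuotientCard (H : Type*) [AddCommGroup H] [Module ℤ H] (r : ℕ) : ℕ :=
  if h : ∃ F : Submodule ℤ H, IsFreeSummand ℤ H r F then Nat.card (H ⧸ h.choose) else 0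

lemma finite_of_isTorsion {H : Type*} [AddCommGroup H] [m : Module ℤ H] [Module.Finite ℤ H]
    (h : Module.IsTorsion ℤ H) : Finite H := by
  obtain rfl : m = AddCommGroup.toIntModule H := Subsingleton.elim _ _
  exact Module.finite_of_fg_torsion H h

lemma finite_torsion (H : Type*) [AddCommGroup H] [Module ℤ H] [Module.Finite ℤ H] :
    Finite (Submodule.torsion ℤ H) :=
  finite_of_isTorsion (m := Submodule.module _) Submodule.torsion_isTorsion

lemma freeQuotientCard_eq {H : Type*} [AddCommGroup H] [Module ℤ H] [Module.Finite ℤ H]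
    {F : Submodule ℤ H}
    (hF : IsFreeSummand ℤ H (Module.finrank ℤ H) F) :
    freeQuotientCard H (Module.finrank ℤ H) = Nat.card (H ⧸ F) := by
  have h : ∃ F : Submodule ℤ H, IsFreeSummand ℤ H (Module.finrank ℤ H) F := ⟨F, hF⟩
  rw [freeQuotientCard, dif_pos h, card_quotient_of_isFreeSummand h.choose_spec,
    card_quotient_of_isFreeSummand hF]

/-- A complex has finitely many subcomplexes. -/
lemma finite_subcomplexes (X : Cx V) : {Y : Cx V | Y.faces ⊆ X.faces}.Finite := by
  refine Set.Finite.of_finite_image (f := Cx.faces) ?_ ?_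
  · refine (X.faces.powerset.finite_toSet).subset ?_
    rintro _ ⟨Y, hY, rfl⟩
    simpa using hY
  · intro Y _ Z _ h
    exact Cx.ext h

section Boundary

variable [LinearOrder V]

lemma card_filter_erase_lt {σ : Finset V} {v w : V} (hv : v ∈ σ) (h : v < w) :
    (σ.filter (· < w)).card = ((σ.erase v).filter (· < w)).card + 1 := by
  rw [Finset.filter_erase, Finset.card_erase_add_one]
  simp [hv, h]

lemma filter_erase_lt {σ : Finset V} {v w : V} (h : w < v) :
    (σ.erase v).filter (· < w) = σ.filter (· < w) := by
  rw [Finset.filter_erase, Finset.erase_eq_of_notMem]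
  simp [h.le]

lemma sum_incidence_erase (ρ σ : Finset V) :
    ∑ v ∈ σ, incidence ρ (σ.erase v) * (-1) ^ (σ.filter (· < v)).card = 0 := by
  let g : V → V → ℤ := fun v w => if v ≠ w ∧ (σ.erase v).erase w = ρ then
    (-1) ^ ((σ.erase v).filter (· < w)).card * (-1) ^ (σ.filter (· < v)).card else 0
  have hS : ∑ v ∈ σ, incidence ρ (σ.erase v) * (-1) ^ (σ.filter (· < v)).card =
      ∑ v ∈ σ, ∑ w ∈ σ, g v w := by
    refine Finset.sum_congr rfl fun v hv => ?_
    rw [incidence, Finset.sum_mul, ← Finset.add_sum_erase σ (g v) hv]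
    have : g v v = 0 := by simp [g]
    rw [this, zero_add]
    refine Finset.sum_congr rfl fun w hw => ?_
    have hvw : v ≠ w := fun h => (Finset.mem_erase.mp hw).1 h.symm
    simp [g, hvw, ite_mul]
  have key : ∀ v ∈ σ, ∀ w ∈ σ, v < w → g v w = - g w v := by
    intro v hv w hw h
    simp only [g, h.ne, h.ne', ne_eq, not_false_eq_true, true_and, Finset.erase_right_comm (a := w)]
    rw [filter_erase_lt h, card_filter_erase_lt hv h]
    split_ifs
    · ring
    · simp
  have hg : ∀ v ∈ σ, ∀ w ∈ σ, g v w = - g w v := by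
    intro v hv w hw
    rcases lt_trichotomy v w with h | h | h
    · exact key v hv w hw h
    · subst h
      simp [g]
    · rw [key w hw v hv h, neg_neg]
  rw [hS]
  have h1 : ∑ v ∈ σ, ∑ w ∈ σ, g v w = - ∑ v ∈ σ, ∑ w ∈ σ, g v w := by
    conv_rhs => rw [Finset.sum_comm]
    rw [← Finset.sum_neg_distrib]
    refine Finset.sum_congr rfl fun v hv => ?_
    rw [← Finset.sum_neg_distrib]
    exact Finset.sum_congr rfl fun w hw => hg v hv w hw
  omega

lemma exists_of_incidence_ne_zero {η σ : Finset V} (h : incidence η σ ≠ 0) :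
    ∃ v ∈ σ, σ.erase v = η := by
  by_contra! hc
  exact h (Finset.sum_eq_zero fun v hv => if_neg (hc v hv))

/-- Consecutive boundary maps compose to zero. -/
lemma boundaryMatrix_mul (R : Type*) [CommRing R] (X A : Cx V) (k : ℤ) :
    boundaryMatrix R X A (k - 1) k * boundaryMatrix R X A k (k + 1) = 0 := by
  ext ρ σ
  have hρ := ρ.2
  have hσ := σ.2
  simp only [relFaces, Finset.mem_filter, Finset.mem_sdiff] at hρ hσ
  have h0 : ∑ η ∈ relFaces X A k, incidence ρ.1 η * incidence η σ.1 = 0 := by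
    rw [← sum_incidence_erase ρ.1 σ.1]
    have : ∀ η ∈ relFaces X A k, incidence ρ.1 η * incidence η σ.1 = ∑ v ∈ σ.1,
        if σ.1.erase v = η then incidence ρ.1 η * (-1) ^ (σ.1.filter (· < v)).card else 0 := by
      intro η _
      conv_lhs => rw [incidence.eq_def η, Finset.mul_sum]
      exact Finset.sum_congr rfl fun v _ => by rw [mul_ite, mul_zero]
    rw [Finset.sum_congr rfl this, Finset.sum_comm]
    refine Finset.sum_congr rfl fun v hv => ?_
    rw [Finset.sum_ite_eq]
    split_ifs with hm
    · rfl
    · by_cases hi : incidence ρ.1 (σ.1.erase v) = 0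
      · rw [hi, zero_mul]
      · exfalso
        obtain ⟨w, hw, hwe⟩ := exists_of_incidence_ne_zero hi
        apply hm
        simp only [relFaces, Finset.mem_filter, Finset.mem_sdiff]
        refine ⟨⟨X.down_closed _ hσ.1.1 _ (Finset.erase_subset _ _), fun hA => hρ.1.2 ?_⟩, ?_⟩
        · rw [← hwe]
          exact A.down_closed _ hA _ (Finset.erase_subset _ _)
        · have := Finset.card_erase_add_one hv
          omega
  rw [← Finset.sum_coe_sort] at h0
  rw [Matrix.mul_apply]
  simp only [boundaryMatrix, Matrix.of_apply, Matrix.zero_apply]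
  have := congrArg (Int.cast : ℤ → R) h0
  simpa only [Int.cast_sum, Int.cast_mul, Int.cast_zero] using this

/-- The groups `H_k(X,A)` of rank zero are finite. -/
lemma finite_homology (X A : Cx V) (k : ℤ) (h : betti X A k = 0) :
    Finite (Homology ℤ X A k) :=
  finite_of_isTorsion (Module.finrank_eq_zero_iff_isTorsion.mp h)

end Boundary

end RelTree

namespace RelTree

section Minors

open Matrix

variable {R : Type*} [CommRing R]

/-- A form of the Cauchy–Binet formula. -/
lemma det_mul_eq_sum_minors {m n : Type*} [Fintype m] [DecidableEq m] [Fintype n] [DecidableEq n]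
    (A : Matrix m n R) (B : Matrix n m R) :
    (A * B).det = ∑ S ∈ Finset.univ.powersetCard (Fintype.card m),
      ((B * A).submatrix (Subtype.val : S → n) Subtype.val).det := by
  have h1 := coeff_det_one_add_X_smul_eq_sum_minors (A * B) (Fintype.card m)
  have h2 := coeff_det_one_add_X_smul_eq_sum_minors (B * A) (Fintype.card m)
  rw [← Finset.card_univ, Finset.powersetCard_self, Finset.sum_singleton] at h1
  have h3 : ((A * B).submatrix (Subtype.val : ((Finset.univ : Finset m) : Type _) → m) Subtype.val).det
      = (A * B).det :=
    det_submatrix_equiv_self (Equiv.subtypeUnivEquiv Finset.mem_univ) (A * B)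
  rw [← h3, ← h1, ← h2, Finset.card_univ, Matrix.map_mul, Matrix.map_mul, ← Matrix.smul_mul,
    det_one_add_mul_comm, Matrix.mul_smul]

lemma det_mul_transpose_of_card_eq {m n : Type*} [Fintype m] [DecidableEq m] [Fintype n]
    [DecidableEq n] (h : Fintype.card m = Fintype.card n) (B : Matrix m n R) :
    (B * Bᵀ).det = (Bᵀ * B).det := by
  let e := Fintype.equivOfCardEq h
  have h1 : B * Bᵀ = B.submatrix id e * (B.submatrix id e)ᵀ := by
    rw [transpose_submatrix, submatrix_mul_equiv, submatrix_id_id]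
  have h2 : (Bᵀ * B).submatrix e e = (B.submatrix id e)ᵀ * B.submatrix id e := by
    rw [transpose_submatrix, ← submatrix_mul _ _ _ id _ Function.bijective_id]
  rw [← det_submatrix_equiv_self e (Bᵀ * B), h1, h2, det_mul_comm]

variable {ι : Type*}

/-- The block of a matrix with rows in `P` and columns in `Q`. -/
def block (F : Matrix ι ι R) (P Q : Finset ι) : Matrix P Q R :=
  F.submatrix Subtype.val Subtype.val

lemma block_map {R' : Type*} [CommRing R'] (f : R →+* R') (F : Matrix ι ι R) (P Q : Finset ι) :
    block (F.map f) P Q = (block F P Q).map f := rfl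

lemma sum_powersetCard_univ_map_subtype {M : Type*} [AddCommMonoid M] (T : Finset ι) (r : ℕ)
    (f : Finset ι → M) :
    ∑ S ∈ (Finset.univ : Finset T).powersetCard r, f (S.map (Function.Embedding.subtype _)) =
      ∑ S ∈ T.powersetCard r, f S := by
  have h : T.powersetCard r = ((Finset.univ : Finset T).powersetCard r).map
      (Finset.mapEmbedding (Function.Embedding.subtype _)).toEmbedding := by
    rw [← Finset.powersetCard_map, Finset.univ_eq_attach, Finset.attach_map_val]
  rw [h, Finset.sum_map]
  rfl

variable [DecidableEq ι]

/-- The Gram determinant of the rows of the block with rows in `P` and columns in `Q`. -/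
def gramDet (F : Matrix ι ι R) (P Q : Finset ι) : R :=
  (block F P Q * (block F P Q)ᵀ).det

lemma gramDet_eq_sum (F : Matrix ι ι R) (P Q : Finset ι) :
    gramDet F P Q = ∑ S ∈ Q.powersetCard P.card, gramDet F P S := by
  rw [gramDet, det_mul_eq_sum_minors, Fintype.card_coe,
    ← sum_powersetCard_univ_map_subtype Q P.card (gramDet F P)]
  refine Finset.sum_congr rfl fun S hS => ?_
  have hc := (Finset.mem_powersetCard.mp hS).2
  rw [gramDet, det_mul_transpose_of_card_eq (by simp [hc])]
  rw [← det_submatrix_equiv_self (S.equivMap (Function.Embedding.subtype _))]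
  rfl

lemma sum_minors_gram (F : Matrix ι ι R) (P Q : Finset ι) (r : ℕ) :
    ∑ S ∈ (Finset.univ : Finset P).powersetCard r,
      ((block F P Q * (block F P Q)ᵀ).submatrix (Subtype.val : S → P) Subtype.val).det =
    ∑ S ∈ P.powersetCard r, gramDet F S Q := by
  rw [← sum_powersetCard_univ_map_subtype P r (gramDet F · Q)]
  refine Finset.sum_congr rfl fun S hS => ?_
  rw [gramDet, ← det_submatrix_equiv_self (S.equivMap (Function.Embedding.subtype _))]
  rfl

lemma gramDet_map {R' : Type*} [CommRing R'] (f : R →+* R') (F : Matrix ι ι R) (P Q : Finset ι) :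
    gramDet (F.map f) P Q = f (gramDet F P Q) := by
  rw [gramDet, gramDet, block_map, ← transpose_map, ← Matrix.map_mul, RingHom.map_det]
  rfl

end Minors

section Eigenvalues

open Polynomial

lemma nonzeroEigenvalueProd_eq {n : Type*} [Fintype n] [DecidableEq n] (M : Matrix n n ℝ)
    (hM : M.IsHermitian) (r : ℕ)
    (hr : ∑ S ∈ (Finset.univ : Finset n).powersetCard r,
      (M.submatrix (Subtype.val : S → n) Subtype.val).det ≠ 0)
    (hlt : ∀ j, r < j → ∑ S ∈ (Finset.univ : Finset n).powersetCard j,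
      (M.submatrix (Subtype.val : S → n) Subtype.val).det = 0) :
    nonzeroEigenvalueProd M = ∑ S ∈ (Finset.univ : Finset n).powersetCard r,
      (M.submatrix (Subtype.val : S → n) Subtype.val).det := by
  have hrn : r ≤ Fintype.card n := by
    by_contra! h
    rw [Finset.powersetCard_eq_empty.mpr (by simpa using h)] at hr
    simp at hr
  set N := Fintype.card n
  have hcoeff := Matrix.charpoly_coeff_eq_sum_minors M
  have hdvd : X ^ (N - r) ∣ M.charpoly := by
    rw [X_pow_dvd_iff]
    intro d hd
    have := hcoeff (N - d) (by omega)
    rw [hlt _ (by omega), mul_zero] at this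
    rwa [show Fintype.card n - (N - d) = d by omega] at this
  obtain ⟨q, hq⟩ := hdvd
  have hmon : q.Monic := by
    have := M.charpoly_monic
    rw [hq] at this
    exact (monic_X_pow _).of_mul_monic_left this
  have hsplit : M.charpoly.Splits := by
    rw [hM.charpoly_eq]
    exact Splits.prod fun i _ => Splits.X_sub_C _
  have hne : (X ^ (N - r) * q : ℝ[X]) ≠ 0 := hq ▸ M.charpoly_monic.ne_zero
  have hqs : q.Splits := hsplit.of_dvd M.charpoly_monic.ne_zero (hq ▸ dvd_mul_left _ _)
  have hqd : q.natDegree = r := by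
    have h1 := M.charpoly_natDegree_eq_dim
    rw [hq, (monic_X_pow _).natDegree_mul hmon, natDegree_X_pow] at h1
    omega
  have hq0 : q.coeff 0 = (-1) ^ r * ∑ S ∈ (Finset.univ : Finset n).powersetCard r,
      (M.submatrix (Subtype.val : S → n) Subtype.val).det := by
    rw [← hcoeff r hrn, hq]
    exact (by simpa using (coeff_X_pow_mul q (N - r) 0).symm)
  have hroot : (0 : ℝ) ∉ q.roots := by
    rw [mem_roots hmon.ne_zero, IsRoot, ← coeff_zero_eq_eval_zero, hq0]
    exact mul_ne_zero (by simp) hr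
  have hfilter : M.charpoly.roots.filter (· ≠ 0) = q.roots := by
    rw [hq, roots_mul hne, roots_X_pow, Multiset.filter_add, Multiset.filter_eq_nil.mpr,
      Multiset.filter_eq_self.mpr, zero_add]
    · rintro x hx rfl
      exact hroot hx
    · intro a ha
      rw [Multiset.nsmul_singleton] at ha
      simpa using Multiset.eq_of_mem_replicate ha
  have hprod := hqs.coeff_zero_eq_prod_roots_of_monic hmon
  rw [hq0, hqd] at hprod
  rw [nonzeroEigenvalueProd, hfilter]
  exact (mul_left_cancel₀ (by simp) hprod).symm

end Eigenvalues

section Lattices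

variable {M N : Type*} [AddCommGroup M] [AddCommGroup N]

lemma index_map_eq_mul {E : Type*} [AddCommGroup E] (f : M →+ N) (π : M →+ E)
    (hπ : Function.Surjective π) (hdisj : f.ker ⊓ π.ker = ⊥) {L : AddSubgroup M}
    (hL : L ≤ f.ker) :
    (L.map π).index = L.relIndex f.ker * (π.ker.map f).relIndex f.range := by
  rw [← AddSubgroup.relIndex_mul_index (AddSubgroup.map_mono hL), ← AddSubgroup.relIndex_comap,
    AddSubgroup.comap_map_eq, ← AddSubgroup.inf_relIndex_right, sup_inf_assoc_of_le _ hL,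
    inf_comm, hdisj, sup_bot_eq, ← AddSubgroup.index_comap, AddSubgroup.comap_map_eq,
    ← AddSubgroup.index_comap_of_surjective _ hπ, AddSubgroup.comap_map_eq, sup_comm]

/-- The elements of `M` with a nonzero multiple in the submodule `N`. -/
def saturation (N : Submodule ℤ M) : Submodule ℤ M :=
  (Submodule.torsion ℤ (M ⧸ N)).comap N.mkQ

lemma mem_saturation {N : Submodule ℤ M} {x : M} :
    x ∈ saturation N ↔ ∃ a : ℤ, a ≠ 0 ∧ a • x ∈ N := by
  simp only [saturation, Submodule.mem_comap, Submodule.mem_torsion_iff, Submodule.mkQ_apply]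
  constructor
  · rintro ⟨a, ha⟩
    exact ⟨a, nonZeroDivisors.coe_ne_zero a, (Submodule.Quotient.mk_eq_zero N).mp ha⟩
  · rintro ⟨a, ha, h⟩
    exact ⟨⟨a, mem_nonZeroDivisors_of_ne_zero ha⟩, (Submodule.Quotient.mk_eq_zero N).mpr h⟩

lemma le_saturation (N : Submodule ℤ M) : N ≤ saturation N :=
  fun x hx => mem_saturation.mpr ⟨1, one_ne_zero, by rwa [one_smul]⟩

lemma saturation_eq_of_le {N K : Submodule ℤ M} (hNK : N ≤ K) (hK : K ≤ saturation N) :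
    saturation N = saturation K := by
  ext x
  rw [mem_saturation, mem_saturation]
  constructor
  · rintro ⟨a, ha, h⟩
    exact ⟨a, ha, hNK h⟩
  · rintro ⟨a, ha, h⟩
    obtain ⟨b, hb, h'⟩ := mem_saturation.mp (hK h)
    exact ⟨b * a, mul_ne_zero hb ha, by rwa [mul_smul]⟩

lemma saturation_ker_le [IsAddTorsionFree N] (f : M →ₗ[ℤ] N) :
    saturation (LinearMap.ker f) ≤ LinearMap.ker f := by
  intro x hx
  obtain ⟨a, ha, h⟩ := mem_saturation.mp hx
  rw [LinearMap.mem_ker, map_smul] at h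
  exact (smul_eq_zero.mp h).resolve_left ha

lemma card_quotient_submoduleOf (N K : Submodule ℤ M) :
    Nat.card (K ⧸ N.submoduleOf K) = N.toAddSubgroup.relIndex K.toAddSubgroup := rfl

lemma finrank_quotient_submoduleOf [Module.Finite ℤ M] {N K : Submodule ℤ M} (h : N ≤ K) :
    Module.finrank ℤ (K ⧸ N.submoduleOf K) + Module.finrank ℤ N = Module.finrank ℤ K := by
  rw [← (Submodule.submoduleOfEquivOfLe h).finrank_eq, Submodule.finrank_quotient_add_finrank]

lemma le_saturation_of_finrank_eq [Module.Finite ℤ M] {N K : Submodule ℤ M} (h : N ≤ K)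
    (hr : Module.finrank ℤ N = Module.finrank ℤ K) : K ≤ saturation N := by
  have h0 : Module.finrank ℤ (K ⧸ N.submoduleOf K) = 0 := by
    have := finrank_quotient_submoduleOf h
    omega
  intro x hx
  have ht := Module.finrank_eq_zero_iff_isTorsion.mp h0
  obtain ⟨a, ha⟩ := @ht (Submodule.Quotient.mk ⟨x, hx⟩)
  exact mem_saturation.mpr ⟨a, nonZeroDivisors.coe_ne_zero a,
    (Submodule.Quotient.mk_eq_zero (N.submoduleOf K)).mp ha⟩

lemma isTorsion_quotient_of_le_saturation {N K : Submodule ℤ M} (hK : K ≤ saturation N) :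
    Module.IsTorsion ℤ (K ⧸ N.submoduleOf K) := by
  intro x
  induction x using Submodule.Quotient.induction_on with
  | H x =>
    obtain ⟨a, ha, h'⟩ := mem_saturation.mp (hK x.2)
    exact ⟨⟨a, mem_nonZeroDivisors_of_ne_zero ha⟩,
      (Submodule.Quotient.mk_eq_zero (N.submoduleOf K)).mpr h'⟩

lemma finrank_eq_of_le_saturation [Module.Finite ℤ M] {N K : Submodule ℤ M} (h : N ≤ K)
    (hK : K ≤ saturation N) : Module.finrank ℤ N = Module.finrank ℤ K := by
  have h0 : Module.finrank ℤ (K ⧸ N.submoduleOf K) = 0 :=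
    Module.finrank_eq_zero_iff_isTorsion.mpr (isTorsion_quotient_of_le_saturation hK)
  have := finrank_quotient_submoduleOf h
  omega

lemma relIndex_ne_zero_of_le_saturation [Module.Finite ℤ M] {N K : Submodule ℤ M}
    (hK : K ≤ saturation N) : N.toAddSubgroup.relIndex K.toAddSubgroup ≠ 0 := by
  have := finite_of_isTorsion (isTorsion_quotient_of_le_saturation hK)
  rw [← card_quotient_submoduleOf]
  exact Nat.card_pos.ne'

lemma freeQuotientCard_eq_relIndex [Module.Finite ℤ M] {N K : Submodule ℤ M} (hN : N ≤ K)
    (hK : saturation K ≤ K) :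
    freeQuotientCard (K ⧸ N.submoduleOf K) (Module.finrank ℤ (K ⧸ N.submoduleOf K)) =
      N.toAddSubgroup.relIndex (saturation N).toAddSubgroup := by
  obtain ⟨F, hF⟩ := exists_isFreeSummand (R := ℤ) (H := K ⧸ N.submoduleOf K)
  rw [freeQuotientCard_eq hF, card_quotient_of_isFreeSummand hF]
  have hS : saturation N ≤ K := fun x hx => by
    obtain ⟨a, ha, h⟩ := mem_saturation.mp hx
    exact hK (mem_saturation.mpr ⟨a, ha, hN h⟩)
  rw [← card_quotient_submoduleOf]
  let f : saturation N →ₗ[ℤ] K ⧸ N.submoduleOf K :=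
    (N.submoduleOf K).mkQ ∘ₗ Submodule.inclusion hS
  have hker : LinearMap.ker f = N.submoduleOf (saturation N) := by
    ext x
    exact Submodule.Quotient.mk_eq_zero (N.submoduleOf K)
  have hrange : LinearMap.range f = Submodule.torsion ℤ (K ⧸ N.submoduleOf K) := by
    ext y
    induction y using Submodule.Quotient.induction_on with
    | H y =>
      rw [Submodule.mem_torsion_iff]
      constructor
      · rintro ⟨x, hx⟩
        obtain ⟨a, ha, h'⟩ := mem_saturation.mp x.2
        refine ⟨⟨a, mem_nonZeroDivisors_of_ne_zero ha⟩, ?_⟩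
        rw [← hx]
        exact (Submodule.Quotient.mk_eq_zero (N.submoduleOf K)).mpr h'
      · rintro ⟨a, ha⟩
        have h' : (a : ℤ) • (y : M) ∈ N := (Submodule.Quotient.mk_eq_zero (N.submoduleOf K)).mp ha
        exact ⟨⟨y, mem_saturation.mpr ⟨a, nonZeroDivisors.coe_ne_zero a, h'⟩⟩, rfl⟩
  rw [← hrange, ← hker]
  exact (Nat.card_congr f.quotKerEquivRange.toEquiv).symm

end Lattices

section IntegerMatrices

open Matrix

variable {m n : Type*} [Fintype m] [DecidableEq m] [Fintype n] [DecidableEq n]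

lemma index_range_mulVecLin (A : Matrix n n ℤ) (hA : LinearMap.ker A.mulVecLin = ⊥) :
    (LinearMap.range A.mulVecLin).toAddSubgroup.index = A.det.natAbs := by
  let e := LinearEquiv.ofInjective A.mulVecLin (LinearMap.ker_eq_bot.mp hA)
  have h := Submodule.natAbs_det_equiv (LinearMap.range A.mulVecLin) e
  have h1 : (LinearMap.range A.mulVecLin).subtype ∘ₗ
      AddMonoidHom.toIntLinearMap (e : (n → ℤ) →+ LinearMap.range A.mulVecLin) =
      Matrix.toLin' A := by
    ext
    rfl
  rw [h1, LinearMap.det_toLin'] at h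
  exact h.symm

lemma det_mul_transpose_eq_index_sq (hc : Fintype.card m = Fintype.card n) (A : Matrix m n ℤ)
    (hA : LinearMap.ker A.mulVecLin = ⊥) :
    (A * Aᵀ).det = ((LinearMap.range A.mulVecLin).toAddSubgroup.index : ℤ) ^ 2 := by
  let e := Fintype.equivOfCardEq hc
  let B : Matrix m m ℤ := A.submatrix id e
  have h1 : A * Aᵀ = B * Bᵀ := by
    rw [transpose_submatrix, submatrix_mul_equiv, submatrix_id_id]
  have h2 : B.mulVecLin = A.mulVecLin ∘ₗ (LinearEquiv.funCongrLeft ℤ ℤ e.symm).toLinearMap := by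
    ext i j
    have h : (Pi.single i 1 : m → ℤ) ∘ e.symm = Pi.single (e i) 1 := by
      ext x
      simp [Pi.single_apply, Equiv.symm_apply_eq]
    simp [B, LinearEquiv.funCongrLeft, LinearMap.funLeft, h]
  have h3 : LinearMap.ker B.mulVecLin = ⊥ := by
    rw [LinearMap.ker_eq_bot] at hA ⊢
    rw [h2]
    exact hA.comp (LinearEquiv.injective _)
  have h4 : LinearMap.range B.mulVecLin = LinearMap.range A.mulVecLin := by
    rw [h2, LinearMap.range_comp_of_range_eq_top _ (LinearEquiv.range _)]
  rw [h1, det_mul, det_transpose, ← h4, index_range_mulVecLin B h3, Int.natCast_natAbs, sq_abs, sq]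

lemma det_mul_transpose_eq_zero (hc : Fintype.card m = Fintype.card n) (A : Matrix m n ℤ)
    {c : n → ℤ} (hc0 : c ≠ 0) (hA : A *ᵥ c = 0) : (A * Aᵀ).det = 0 := by
  rw [det_mul_transpose_of_card_eq hc, ← exists_mulVec_eq_zero_iff]
  exact ⟨c, hc0, by rw [← mulVec_mulVec, hA, mulVec_zero]⟩

end IntegerMatrices

section Blocks

open Matrix

variable {ι : Type*} [DecidableEq ι] (F : Matrix ι ι ℤ) {P Q R S T : Finset ι}

/-- The image of the integer matrix `block F P Q`. -/
abbrev blockRange (P Q : Finset ι) : Submodule ℤ (P → ℤ) := LinearMap.range (block F P Q).mulVecLin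

/-- The kernel of the integer matrix `block F P Q`. -/
abbrev blockKer (P Q : Finset ι) : Submodule ℤ (Q → ℤ) := LinearMap.ker (block F P Q).mulVecLin

/-- The columns in `S` form a maximal independent set of columns of `block F P T`. -/
structure IsColBasis (P T S : Finset ι) : Prop where
  subset : S ⊆ T
  ker_eq_bot : blockKer F P S = ⊥
  card_eq : S.card = Module.finrank ℤ (blockRange F P T)

/-- The extension of a vector by zero. -/
def extendZero (x : S → ℤ) (i : ι) : ℤ := if h : i ∈ S then x ⟨i, h⟩ else 0

lemma extendZero_coe (x : S → ℤ) (i : S) : extendZero x i = x i := by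
  simp [extendZero]

lemma extendZero_of_notMem (x : S → ℤ) {i : ι} (h : i ∉ S) : extendZero x i = 0 := by
  simp [extendZero, h]

omit [DecidableEq ι] in
lemma block_mulVec_apply (y : ι → ℤ) (l : P) :
    (block F P T *ᵥ fun i => y i) l = ∑ i ∈ T, F l i * y i := by
  rw [← Finset.sum_coe_sort]
  rfl

omit [DecidableEq ι] in
lemma block_mulVec_of_subset (hST : S ⊆ T) (y : ι → ℤ) (hy : ∀ i ∈ T, i ∉ S → y i = 0) :
    (block F P T *ᵥ fun i => y i) = block F P S *ᵥ fun i => y i := by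
  ext l
  rw [block_mulVec_apply, block_mulVec_apply]
  exact (Finset.sum_subset hST fun i hi hiS => by rw [hy i hi hiS, mul_zero]).symm

lemma block_mulVec_extendZero (hST : S ⊆ T) (x : S → ℤ) :
    (block F P T *ᵥ fun i => extendZero x i) = block F P S *ᵥ x := by
  rw [block_mulVec_of_subset F hST _ fun i _ hi => extendZero_of_notMem x hi]
  congr 1
  ext i
  exact extendZero_coe x i

lemma blockRange_mono (hST : S ⊆ T) : blockRange F P S ≤ blockRange F P T := by
  rintro _ ⟨x, rfl⟩
  exact ⟨fun i => extendZero x i, block_mulVec_extendZero F hST x⟩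

omit [DecidableEq ι] in
lemma finrank_range_add_finrank_ker_block (P Q : Finset ι) :
    Module.finrank ℤ (blockRange F P Q) + Module.finrank ℤ (blockKer F P Q) = Q.card := by
  have h := Submodule.finrank_quotient_add_finrank (blockKer F P Q)
  rw [(block F P Q).mulVecLin.quotKerEquivRange.finrank_eq] at h
  simpa using h

omit [DecidableEq ι] in
lemma blockKer_eq_bot_iff :
    blockKer F P S = ⊥ ↔ Module.finrank ℤ (blockRange F P S) = S.card := by
  have := finrank_range_add_finrank_ker_block F P S
  rw [← Submodule.finrank_eq_zero (R := ℤ)]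
  omega

variable {F}

omit [DecidableEq ι] in
lemma IsColBasis.finrank_eq (h : IsColBasis F P T S) :
    Module.finrank ℤ (blockRange F P S) = Module.finrank ℤ (blockRange F P T) := by
  rw [(blockKer_eq_bot_iff F).mp h.ker_eq_bot, h.card_eq]

lemma IsColBasis.saturation_eq (h : IsColBasis F P T S) :
    saturation (blockRange F P S) = saturation (blockRange F P T) :=
  saturation_eq_of_le (blockRange_mono F h.subset)
    (le_saturation_of_finrank_eq (blockRange_mono F h.subset) h.finrank_eq)

variable (F)

lemma exists_isColBasis (P T : Finset ι) : ∃ S, IsColBasis F P T S := by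
  classical
  obtain ⟨s, hs, hmax⟩ := exists_maximal_linearIndepOn ℤ (block F P T).col
  let S : Finset ι := (s.toFinset).map (Function.Embedding.subtype _)
  have hST : S ⊆ T := by
    intro i hi
    obtain ⟨j, -, rfl⟩ := Finset.mem_map.mp hi
    exact j.2
  have hmem : ∀ j : T, j ∈ s ↔ (j : ι) ∈ S := by
    intro j
    simp [S]
  have hker : blockKer F P S = ⊥ := by
    rw [LinearMap.ker_eq_bot']
    intro x hx
    have h1 := (linearIndepOn_iff'.mp hs) s.toFinset (fun i => extendZero x i) (by simp) (by
      have h2 := block_mulVec_extendZero F (P := P) hST x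
      rw [mulVecLin_apply] at hx
      rw [hx] at h2
      rw [← h2, Finset.sum_subset (Finset.subset_univ _)]
      · ext l
        simp [mulVec, dotProduct, Matrix.col, mul_comm]
      · intro i _ hi
        rw [extendZero_of_notMem x (by rwa [← hmem, ← Set.mem_toFinset]), zero_smul])
    ext i
    have := h1 ⟨i, hST i.2⟩ (by rw [Set.mem_toFinset, hmem]; exact i.2)
    rwa [extendZero_coe] at this
  refine ⟨S, hST, hker, ?_⟩
  rw [← (blockKer_eq_bot_iff F).mp hker]
  refine finrank_eq_of_le_saturation (blockRange_mono F hST) ?_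
  have hcol : ∀ j : T, (j : ι) ∈ S → (block F P T).col j ∈ blockRange F P S := by
    intro j hj
    refine ⟨Pi.single ⟨j, hj⟩ 1, ?_⟩
    rw [mulVecLin_apply, mulVec_single_one]
    rfl
  have hspan : Submodule.span ℤ ((block F P T).col '' s) ≤ blockRange F P S := by
    rw [Submodule.span_le]
    rintro _ ⟨j, hj, rfl⟩
    exact hcol j ((hmem j).mp hj)
  rw [blockRange, Matrix.range_mulVecLin, Submodule.span_le]
  rintro _ ⟨j, rfl⟩
  by_cases hj : j ∈ s
  · exact le_saturation _ (hcol j ((hmem j).mp hj))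
  · obtain ⟨a, ha, h⟩ := hmax j hj
    exact mem_saturation.mpr ⟨a, ha, hspan h⟩

lemma gramDet_eq_zero_of_ker_ne_bot (hc : R.card = S.card) (h : blockKer F R S ≠ ⊥) :
    gramDet F R S = 0 := by
  obtain ⟨c, hc', hc0⟩ := (Submodule.ne_bot_iff _).mp h
  exact det_mul_transpose_eq_zero (by simpa using hc) _ hc0 hc'

omit [DecidableEq ι] in
lemma blockKer_mono (hRP : R ⊆ P) : blockKer F P S ≤ blockKer F R S := by
  intro x hx
  rw [LinearMap.mem_ker] at hx ⊢
  ext l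
  exact congrFun hx ⟨l, hRP l.2⟩

lemma gramDet_eq_zero_of_finrank_lt (hRP : R ⊆ P) (hST : S ⊆ T) (hc : R.card = S.card)
    (h : Module.finrank ℤ (blockRange F P T) < S.card) : gramDet F R S = 0 := by
  refine gramDet_eq_zero_of_ker_ne_bot F hc fun h0 => ?_
  have h1 : blockKer F P S = ⊥ := eq_bot_iff.mpr (h0 ▸ blockKer_mono F hRP)
  have h2 := Submodule.finrank_mono (blockRange_mono F (P := P) hST)
  rw [(blockKer_eq_bot_iff F).mp h1] at h2
  omega

lemma gramDet_eq_zero_of_not_isColBasis (hRP : R ⊆ P) (hST : S ⊆ T) (hc : R.card = S.card)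
    (hr : S.card = Module.finrank ℤ (blockRange F P T)) (h : ¬ IsColBasis F P T S) :
    gramDet F R S = 0 := by
  refine gramDet_eq_zero_of_ker_ne_bot F hc fun h0 => h ⟨hST, ?_, hr⟩
  exact eq_bot_iff.mpr (h0 ▸ blockKer_mono F hRP)

section Complex

variable {F} (hF : block F Q P * block F P T = 0)
  (hr : Module.finrank ℤ (blockRange F P T) + Module.finrank ℤ (blockRange F Q P) = P.card)

include hF

lemma blockRange_le_blockKer (hST : S ⊆ T) : blockRange F P S ≤ blockKer F Q P := by
  refine (blockRange_mono F hST).trans ?_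
  rintro _ ⟨x, rfl⟩
  rw [LinearMap.mem_ker, mulVecLin_apply, mulVecLin_apply, mulVec_mulVec, hF, zero_mulVec]

include hr

lemma blockKer_le_saturation (hS : IsColBasis F P T S) :
    blockKer F Q P ≤ saturation (blockRange F P S) := by
  refine le_saturation_of_finrank_eq (blockRange_le_blockKer hF hS.subset) ?_
  have := finrank_range_add_finrank_ker_block F Q P
  rw [hS.finrank_eq]
  omega

lemma gramDet_eq_zero_of_not_isColBasis_compl (hS : IsColBasis F P T S) {U : Finset ι} (hU : U ⊆ P)
    (hUc : U.card = Module.finrank ℤ (blockRange F Q P)) (h : ¬ IsColBasis F Q P U) :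
    gramDet F (P \ U) S = 0 := by
  have hker : blockKer F Q U ≠ ⊥ := fun h0 => h ⟨hU, h0, hUc⟩
  obtain ⟨c, hc, hc0⟩ := (Submodule.ne_bot_iff _).mp hker
  rw [LinearMap.mem_ker, mulVecLin_apply] at hc
  have hcK : (fun i : P => extendZero c i) ∈ blockKer F Q P := by
    rw [LinearMap.mem_ker, mulVecLin_apply, block_mulVec_extendZero F hU, hc]
  obtain ⟨a, ha, x, hx⟩ := mem_saturation.mp (blockKer_le_saturation hF hr hS hcK)
  refine gramDet_eq_zero_of_ker_ne_bot F ?_ ((Submodule.ne_bot_iff _).mpr ⟨x, ?_, ?_⟩)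
  · rw [Finset.card_sdiff_of_subset hU, hS.card_eq]
    omega
  · rw [LinearMap.mem_ker]
    ext l
    have hl := Finset.mem_sdiff.mp l.2
    have := congrFun hx ⟨l, hl.1⟩
    rw [Pi.smul_apply, extendZero_of_notMem c hl.2, smul_zero] at this
    exact this
  · rintro rfl
    rw [map_zero] at hx
    refine hc0 (funext fun i => ?_)
    have := congrFun hx ⟨i, hU i.2⟩
    rw [Pi.smul_apply, extendZero_coe, smul_eq_mul] at this
    exact (mul_eq_zero.mp this.symm).resolve_left ha

lemma gramDet_mul_relIndex_sq (hS : IsColBasis F P T S) {U : Finset ι} (hU : IsColBasis F Q P U) :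
    gramDet F (P \ U) S * ((blockRange F Q P).toAddSubgroup.relIndex
        (saturation (blockRange F Q P)).toAddSubgroup : ℤ) ^ 2 =
      ((blockRange F P S).toAddSubgroup.relIndex (blockKer F Q P).toAddSubgroup : ℤ) ^ 2 *
      ((blockRange F Q U).toAddSubgroup.relIndex
        (saturation (blockRange F Q U)).toAddSubgroup : ℤ) ^ 2 := by
  let π : (P → ℤ) →ₗ[ℤ] ((P \ U : Finset ι) → ℤ) :=
    LinearMap.funLeft ℤ ℤ fun i => ⟨i, (Finset.mem_sdiff.mp i.2).1⟩
  have hπ : Function.Surjective π := LinearMap.funLeft_surjective_of_injective _ _ _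
    fun i j h => Subtype.ext (congrArg (fun z : P => (z : ι)) h)
  have hmemπ : ∀ x : P → ℤ, x ∈ LinearMap.ker π ↔ ∀ i ∈ P, i ∉ U → extendZero x i = 0 := by
    intro x
    rw [LinearMap.mem_ker]
    constructor
    · intro h i hi hiU
      have := congrFun h ⟨i, Finset.mem_sdiff.mpr ⟨hi, hiU⟩⟩
      rw [extendZero, dif_pos hi]
      exact this
    · intro h
      ext i
      have hi := Finset.mem_sdiff.mp i.2
      have := h i hi.1 hi.2
      rw [extendZero, dif_pos hi.1] at this
      exact this
  have hext : ∀ x : P → ℤ, (fun i : P => extendZero x i) = x := fun x => funext (extendZero_coe x)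
  have hres : ∀ x ∈ LinearMap.ker π,
      (block F Q U *ᵥ fun i => extendZero x i) = block F Q P *ᵥ x := by
    intro x hx
    rw [← block_mulVec_of_subset F hU.subset _ ((hmemπ x).mp hx), hext]
  have hmap : (LinearMap.ker π).map (block F Q P).mulVecLin = blockRange F Q U := by
    apply le_antisymm
    · rintro _ ⟨x, hx, rfl⟩
      exact ⟨_, hres x hx⟩
    · rintro _ ⟨c, rfl⟩
      refine ⟨fun i => extendZero c i, (hmemπ _).mpr fun i hi hiU => ?_,
        block_mulVec_extendZero F hU.subset c⟩
      rw [extendZero, dif_pos hi, extendZero_of_notMem c hiU]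
  have hdisj : blockKer F Q P ⊓ LinearMap.ker π = ⊥ := by
    rw [eq_bot_iff]
    rintro x ⟨hx, hxπ⟩
    have h1 : (fun i : U => extendZero x i) ∈ blockKer F Q U := by
      rw [LinearMap.mem_ker, mulVecLin_apply, hres x hxπ]
      exact hx
    rw [hU.ker_eq_bot, Submodule.mem_bot] at h1
    rw [Submodule.mem_bot]
    ext i
    by_cases hi : (i : ι) ∈ U
    · rw [← extendZero_coe x i]
      exact congrFun h1 ⟨i, hi⟩
    · rw [← extendZero_coe x i]
      exact (hmemπ x).mp hxπ i i.2 hi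
  have hcomp : (block F (P \ U) S).mulVecLin = π ∘ₗ (block F P S).mulVecLin := rfl
  have hL := blockRange_le_blockKer hF hS.subset
  have hker : blockKer F (P \ U) S = ⊥ := by
    rw [eq_bot_iff]
    intro x hx
    have h1 : (block F P S).mulVecLin x ∈ blockKer F Q P ⊓ LinearMap.ker π :=
      ⟨hL ⟨x, rfl⟩, hx⟩
    rw [hdisj] at h1
    rw [← hS.ker_eq_bot]
    exact h1
  have hmapL : (blockRange F P S).map π = blockRange F (P \ U) S := by
    rw [blockRange, blockRange, hcomp, LinearMap.range_comp]
  have hindex := index_map_eq_mul (block F Q P).mulVecLin.toAddMonoidHom π.toAddMonoidHom hπ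
    (L := (blockRange F P S).toAddSubgroup) (congrArg Submodule.toAddSubgroup hdisj) hL
  have e1 : (blockRange F P S).toAddSubgroup.map π.toAddMonoidHom =
      (blockRange F (P \ U) S).toAddSubgroup := congrArg Submodule.toAddSubgroup hmapL
  have e2 : (π.toAddMonoidHom.ker).map (block F Q P).mulVecLin.toAddMonoidHom =
      (blockRange F Q U).toAddSubgroup := congrArg Submodule.toAddSubgroup hmap
  rw [e1, e2] at hindex
  have htower := AddSubgroup.relIndex_mul_relIndex _ _ _
    (Submodule.toAddSubgroup_mono (blockRange_mono F (P := Q) hU.subset))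
    (Submodule.toAddSubgroup_mono (le_saturation (blockRange F Q P)))
  have hcard : Fintype.card (P \ U : Finset ι) = Fintype.card S := by
    rw [Fintype.card_coe, Fintype.card_coe, Finset.card_sdiff_of_subset hU.subset, hS.card_eq,
      hU.card_eq]
    omega
  have hdet : gramDet F (P \ U) S = _ := det_mul_transpose_eq_index_sq hcard _ hker
  rw [hdet, hindex, hU.saturation_eq, ← htower]
  push_cast
  rw [← mul_pow, ← mul_pow, mul_assoc]
  rfl

end Complex

open Classical in
/-- The maximal independent sets of columns of `block F P T`. -/
noncomputable def colBases (P T : Finset ι) : Finset (Finset ι) :=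
  T.powerset.filter (IsColBasis F P T)

omit [DecidableEq ι] in
lemma mem_colBases : S ∈ colBases F P T ↔ IsColBasis F P T S := by
  simp only [colBases, Finset.mem_filter, Finset.mem_powerset, and_iff_right_iff_imp]
  exact fun h => h.subset

omit [DecidableEq ι] in
lemma colBases_subset :
    colBases F P T ⊆ T.powersetCard (Module.finrank ℤ (blockRange F P T)) := by
  intro S hS
  rw [mem_colBases] at hS
  exact Finset.mem_powersetCard.mpr ⟨hS.subset, hS.card_eq⟩

lemma gramDet_eq_sum_colBases (hRP : R ⊆ P)
    (hR : R.card = Module.finrank ℤ (blockRange F P T)) :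
    gramDet F R T = ∑ S ∈ colBases F P T, gramDet F R S := by
  rw [gramDet_eq_sum, hR]
  refine (Finset.sum_subset (colBases_subset F) fun S hS hS' => ?_).symm
  rw [mem_colBases] at hS'
  have h := Finset.mem_powersetCard.mp hS
  exact gramDet_eq_zero_of_not_isColBasis F hRP h.1 (hR.trans h.2.symm) h.2 hS'

lemma gramDet_eq_zero_of_finrank_lt_card (hRP : R ⊆ P)
    (hR : Module.finrank ℤ (blockRange F P T) < R.card) : gramDet F R T = 0 := by
  rw [gramDet_eq_sum]
  refine Finset.sum_eq_zero fun S hS => ?_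
  have h := Finset.mem_powersetCard.mp hS
  exact gramDet_eq_zero_of_finrank_lt F hRP h.1 h.2.symm (h.2 ▸ hR)

section GramSums

variable {F} (hF : block F Q P * block F P T = 0)
  (hr : Module.finrank ℤ (blockRange F P T) + Module.finrank ℤ (blockRange F Q P) = P.card)

include hF hr

lemma gramDet_compl_mul_relIndex_sq {U : Finset ι} (hU : IsColBasis F Q P U) :
    gramDet F (P \ U) T * ((blockRange F Q P).toAddSubgroup.relIndex
        (saturation (blockRange F Q P)).toAddSubgroup : ℤ) ^ 2 =
      (∑ S ∈ colBases F P T,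
        ((blockRange F P S).toAddSubgroup.relIndex (blockKer F Q P).toAddSubgroup : ℤ) ^ 2) *
      ((blockRange F Q U).toAddSubgroup.relIndex
        (saturation (blockRange F Q U)).toAddSubgroup : ℤ) ^ 2 := by
  have hc := Finset.card_sdiff_of_subset hU.subset
  have hUc := hU.card_eq
  rw [gramDet_eq_sum_colBases F Finset.sdiff_subset (by omega), Finset.sum_mul, Finset.sum_mul]
  exact Finset.sum_congr rfl fun S hS =>
    gramDet_mul_relIndex_sq hF hr ((mem_colBases F).mp hS) hU

lemma sum_gramDet_mul_relIndex_sq :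
    (∑ R ∈ P.powersetCard (Module.finrank ℤ (blockRange F P T)), gramDet F R T) *
      ((blockRange F Q P).toAddSubgroup.relIndex
        (saturation (blockRange F Q P)).toAddSubgroup : ℤ) ^ 2 =
      (∑ S ∈ colBases F P T,
        ((blockRange F P S).toAddSubgroup.relIndex (blockKer F Q P).toAddSubgroup : ℤ) ^ 2) *
      ∑ U ∈ colBases F Q P, ((blockRange F Q U).toAddSubgroup.relIndex
        (saturation (blockRange F Q U)).toAddSubgroup : ℤ) ^ 2 := by
  have h1 : ∑ R ∈ P.powersetCard (Module.finrank ℤ (blockRange F P T)), gramDet F R T =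
      ∑ U ∈ P.powersetCard (Module.finrank ℤ (blockRange F Q P)), gramDet F (P \ U) T := by
    refine Finset.sum_nbij' (P \ ·) (P \ ·) ?_ ?_ ?_ ?_ ?_
    all_goals
      intro R hR
      obtain ⟨hRP, hRc⟩ := Finset.mem_powersetCard.mp hR
    · exact Finset.mem_powersetCard.mpr
        ⟨Finset.sdiff_subset, by rw [Finset.card_sdiff_of_subset hRP]; omega⟩
    · exact Finset.mem_powersetCard.mpr
        ⟨Finset.sdiff_subset, by rw [Finset.card_sdiff_of_subset hRP]; omega⟩
    · exact Finset.sdiff_sdiff_eq_self hRP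
    · exact Finset.sdiff_sdiff_eq_self hRP
    · rw [Finset.sdiff_sdiff_eq_self hRP]
  have h2 : ∑ U ∈ colBases F Q P, gramDet F (P \ U) T =
      ∑ U ∈ P.powersetCard (Module.finrank ℤ (blockRange F Q P)), gramDet F (P \ U) T := by
    refine Finset.sum_subset (colBases_subset F) fun U hU hU' => ?_
    rw [mem_colBases] at hU'
    obtain ⟨hUP, hUc⟩ := Finset.mem_powersetCard.mp hU
    rw [gramDet_eq_sum_colBases F Finset.sdiff_subset
      (by rw [Finset.card_sdiff_of_subset hUP]; omega)]
    exact Finset.sum_eq_zero fun S hS =>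
      gramDet_eq_zero_of_not_isColBasis_compl hF hr ((mem_colBases F).mp hS) hUP hUc hU'
  rw [h1, ← h2, Finset.sum_mul, Finset.mul_sum]
  exact Finset.sum_congr rfl fun U hU =>
    gramDet_compl_mul_relIndex_sq hF hr ((mem_colBases F).mp hU)

end GramSums

end Blocks

section Complexes

open Matrix

variable {V : Type*} [LinearOrder V]

/-- The matrix of all incidence numbers. -/
def incidenceMatrix (V : Type*) [LinearOrder V] : Matrix (Finset V) (Finset V) ℤ :=
  Matrix.of incidence

lemma boundary_int (X A : Cx V) (i j : ℤ) : boundary ℤ X A i j =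
    (block (incidenceMatrix V) (relFaces X A i) (relFaces X A j)).mulVecLin := rfl

lemma mem_relFaces {X A : Cx V} {k : ℤ} {σ : Finset V} :
    σ ∈ relFaces X A k ↔ (σ ∈ X.faces ∧ σ ∉ A.faces) ∧ (σ.card : ℤ) = k + 1 := by
  rw [relFaces, Finset.mem_filter, Finset.mem_sdiff]

lemma mem_skeleton {X : Cx V} {k : ℤ} {σ : Finset V} :
    σ ∈ (skeleton X k).faces ↔ σ ∈ X.faces ∧ ((σ.card : ℤ) ≤ k + 1 ∨ σ = ∅) := by
  rw [skeleton, Finset.mem_filter]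

lemma block_mul_block_relFaces (X A : Cx V) {i j l : ℤ} (hi : i = j - 1) (hl : l = j + 1) :
    block (incidenceMatrix V) (relFaces X A i) (relFaces X A j) *
      block (incidenceMatrix V) (relFaces X A j) (relFaces X A l) = 0 := by
  subst hi hl
  exact boundaryMatrix_mul ℤ X A j

lemma card_homology (X A : Cx V) {i j l : ℤ} (hi : i = j - 1) (hl : l = j + 1) :
    Nat.card (Homology ℤ X A j) =
      (blockRange (incidenceMatrix V) (relFaces X A j) (relFaces X A l)).toAddSubgroup.relIndex
        (blockKer (incidenceMatrix V) (relFaces X A i) (relFaces X A j)).toAddSubgroup := by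
  subst hi hl
  rfl

lemma betti_add_finrank (X A : Cx V) {i j l : ℤ} (hi : i = j - 1) (hl : l = j + 1) :
    betti X A j +
      Module.finrank ℤ (blockRange (incidenceMatrix V) (relFaces X A j) (relFaces X A l)) +
      Module.finrank ℤ (blockRange (incidenceMatrix V) (relFaces X A i) (relFaces X A j)) =
      (relFaces X A j).card := by
  have h1 := finrank_range_add_finrank_ker_block (incidenceMatrix V) (relFaces X A i)
    (relFaces X A j)
  have h2 := finrank_quotient_submoduleOf
    (blockRange_le_blockKer (block_mul_block_relFaces X A hi hl) subset_rfl)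
  have h3 : betti X A j = Module.finrank ℤ
      (blockKer (incidenceMatrix V) (relFaces X A i) (relFaces X A j) ⧸
        (blockRange (incidenceMatrix V) (relFaces X A j) (relFaces X A l)).submoduleOf
          (blockKer (incidenceMatrix V) (relFaces X A i) (relFaces X A j))) := by
    subst hi hl
    rfl
  omega

lemma freeQuotientCard_homology (X A : Cx V) {j l : ℤ} (hl : l = j + 1) :
    freeQuotientCard (Homology ℤ X A j) (betti X A j) =
      (blockRange (incidenceMatrix V) (relFaces X A j) (relFaces X A l)).toAddSubgroup.relIndex
        (saturation (blockRange (incidenceMatrix V) (relFaces X A j)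
          (relFaces X A l))).toAddSubgroup := by
  subst hl
  have hle := blockRange_le_blockKer (block_mul_block_relFaces X A (j := j) rfl rfl) subset_rfl
  have h := freeQuotientCard_eq_relIndex hle (saturation_ker_le _)
  unfold betti Homology
  simp only [boundary_int]
  exact h

/-- `Y` lies between `A_(k)` and `X_(k)` and contains the `(k-1)`-skeleton of `X`. -/
structure IsIntermediate (X A : Cx V) (k : ℤ) (Y : Cx V) : Prop where
  le : (skeleton A k).faces ⊆ Y.faces
  ge : Y.faces ⊆ (skeleton X k).faces
  skeleton_eq : skeleton Y (k - 1) = skeleton X (k - 1)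

lemma IsSpanning.isIntermediate {X A Y : Cx V} {k : ℤ} (h : IsSpanning X A k Y) :
    IsIntermediate X A k Y := ⟨h.le, h.ge, h.skeleton_eq⟩

section Intermediate

variable {X A Y : Cx V} {k : ℤ}

lemma IsIntermediate.mem_iff (h : IsIntermediate X A k Y) {σ : Finset V}
    (hσ : (σ.card : ℤ) ≤ k ∨ σ = ∅) : σ ∈ Y.faces ↔ σ ∈ X.faces := by
  have h1 := congrArg (fun Z : Cx V => σ ∈ Z.faces) h.skeleton_eq
  simpa [mem_skeleton, hσ] using h1

lemma IsIntermediate.relFaces_eq_of_lt (h : IsIntermediate X A k Y) {j : ℤ} (hj : j < k) :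
    relFaces Y (skeleton A k) j = relFaces X A j := by
  ext σ
  rw [mem_relFaces, mem_relFaces, mem_skeleton]
  refine and_congr_left fun hc => ?_
  rw [h.mem_iff (Or.inl (by omega))]
  have : (σ.card : ℤ) ≤ k + 1 := by omega
  tauto

lemma IsIntermediate.relFaces_eq_empty (h : IsIntermediate X A k Y) {j : ℤ} (hj : k < j) :
    relFaces Y (skeleton A k) j = ∅ := by
  ext σ
  simp only [mem_relFaces, Finset.notMem_empty, iff_false]
  rintro ⟨⟨h1, h2⟩, hc⟩
  rcases (mem_skeleton.mp (h.ge h1)).2 with h3 | rfl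
  · omega
  · exact h2 (skeleton A k).empty_mem

lemma IsIntermediate.relFaces_subset (h : IsIntermediate X A k Y) :
    relFaces Y (skeleton A k) k ⊆ relFaces X A k := by
  intro σ hσ
  rw [mem_relFaces, mem_skeleton] at hσ
  rw [mem_relFaces]
  obtain ⟨⟨h1, h2⟩, hc⟩ := hσ
  exact ⟨⟨(mem_skeleton.mp (h.ge h1)).1, fun h3 => h2 ⟨h3, Or.inl hc.le⟩⟩, hc⟩

lemma isIntermediate_skeleton (hA : A.faces ⊆ X.faces) :
    IsIntermediate X A k (skeleton X k) where
  le σ hσ := by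
    rw [mem_skeleton] at hσ ⊢
    exact ⟨hA hσ.1, hσ.2⟩
  ge := subset_rfl
  skeleton_eq := by
    ext σ
    simp only [mem_skeleton]
    constructor
    · exact fun h => ⟨h.1.1, h.2⟩
    · rintro ⟨h1, h2⟩
      exact ⟨⟨h1, h2.imp_left fun h => by omega⟩, h2⟩

lemma relFaces_skeleton_self : relFaces (skeleton X k) (skeleton A k) k = relFaces X A k := by
  ext σ
  rw [mem_relFaces, mem_relFaces, mem_skeleton, mem_skeleton]
  refine and_congr_left fun hc => ?_
  have := hc.le
  tauto

lemma IsIntermediate.betti_top (h : IsIntermediate X A k Y) :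
    betti Y (skeleton A k) k + Module.finrank ℤ (blockRange (incidenceMatrix V)
      (relFaces X A (k - 1)) (relFaces Y (skeleton A k) k)) =
    (relFaces Y (skeleton A k) k).card := by
  have h1 := betti_add_finrank Y (skeleton A k) (j := k) rfl rfl
  have h2 := finrank_range_add_finrank_ker_block (incidenceMatrix V)
    (relFaces Y (skeleton A k) k) (relFaces Y (skeleton A k) (k + 1))
  have h3 : (relFaces Y (skeleton A k) (k + 1)).card = 0 := by
    rw [h.relFaces_eq_empty (lt_add_one k), Finset.card_empty]
  rw [h.relFaces_eq_of_lt (sub_one_lt k)] at h1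
  omega

lemma IsIntermediate.isSpanning_iff (hA : A.faces ⊆ X.faces) (h : IsIntermediate X A k Y) :
    IsSpanning X A k Y ↔ IsColBasis (incidenceMatrix V) (relFaces X A (k - 1)) (relFaces X A k)
      (relFaces Y (skeleton A k) k) := by
  have h1 := h.betti_top
  have h2 := (isIntermediate_skeleton hA (k := k)).betti_top
  rw [relFaces_skeleton_self] at h2
  constructor
  · intro hs
    have h3 := hs.betti_top
    have h4 := hs.fNum_eq
    rw [fNum, fNum] at h4
    exact ⟨h.relFaces_subset, (blockKer_eq_bot_iff _).mpr (by omega), by omega⟩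
  · intro hb
    have h3 := (blockKer_eq_bot_iff _).mp hb.ker_eq_bot
    have h4 := hb.card_eq
    refine ⟨h.le, h.ge, h.skeleton_eq, by omega, ?_⟩
    rw [fNum, fNum]
    omega

lemma IsSpanning.isColBasis (hA : A.faces ⊆ X.faces) (h : IsSpanning X A k Y) :
    IsColBasis (incidenceMatrix V) (relFaces X A (k - 1)) (relFaces X A k)
      (relFaces Y (skeleton A k) k) :=
  (h.isIntermediate.isSpanning_iff hA).mp h

lemma IsSpanning.betti_eq (hA : A.faces ⊆ X.faces) (h : IsSpanning X A k Y) :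
    betti Y (skeleton A k) (k - 1) = betti X A (k - 1) := by
  have h1 := betti_add_finrank Y (skeleton A k) (j := k - 1) (l := k) rfl (by omega)
  have h2 := betti_add_finrank X A (j := k - 1) (l := k) rfl (by omega)
  rw [h.isIntermediate.relFaces_eq_of_lt (sub_one_lt k),
    h.isIntermediate.relFaces_eq_of_lt (by omega : k - 1 - 1 < k), (h.isColBasis hA).finrank_eq]
    at h1
  omega

lemma forests_eq (hA : A.faces ⊆ X.faces) : forests X A k = {Y | IsSpanning X A k Y} := by
  ext Y
  exact ⟨fun h => h.1, fun h => ⟨h, h.betti_eq hA⟩⟩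

lemma trees_subset_forests (hA : A.faces ⊆ X.faces) : trees X A k ⊆ forests X A k := by
  rw [forests_eq hA]
  exact fun Y h => h.1

lemma betti_eq_zero_of_mem_trees (hA : A.faces ⊆ X.faces) (hY : Y ∈ trees X A k) :
    betti X A (k - 1) = 0 :=
  (hY.1.betti_eq hA).symm.trans hY.2

lemma trees_eq_forests (h : betti X A (k - 1) = 0) :
    trees X A k = forests X A k := by
  rw [trees, forests, h]

/-- The complex with `(k-1)`-skeleton `X_(k-1)` whose `k`-faces are those of `A` and those in
`S`. -/
def addFaces (X A : Cx V) (k : ℤ) (S : Finset (Finset V)) : Cx V where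
  faces := X.faces.filter fun σ => ((σ.card : ℤ) ≤ k ∨ σ = ∅) ∨
    ((σ.card : ℤ) = k + 1 ∧ (σ ∈ A.faces ∨ σ ∈ S))
  empty_mem := by simp [X.empty_mem]
  down_closed := by
    intro σ hσ τ hτ
    rw [Finset.mem_filter] at hσ ⊢
    refine ⟨X.down_closed σ hσ.1 τ hτ, ?_⟩
    have hc := Finset.card_le_card hτ
    rcases hσ.2 with (h | rfl) | h
    · exact Or.inl (Or.inl (by omega))
    · exact Or.inl (Or.inr (Finset.subset_empty.mp hτ))
    · by_cases hlt : (τ.card : ℤ) ≤ k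
      · exact Or.inl (Or.inl hlt)
      · rw [Finset.eq_of_subset_of_card_le hτ (by omega)]
        exact Or.inr h

lemma mem_addFaces {S : Finset (Finset V)} {σ : Finset V} : σ ∈ (addFaces X A k S).faces ↔
    σ ∈ X.faces ∧ (((σ.card : ℤ) ≤ k ∨ σ = ∅) ∨
      ((σ.card : ℤ) = k + 1 ∧ (σ ∈ A.faces ∨ σ ∈ S))) := by
  rw [addFaces, Finset.mem_filter]

lemma isIntermediate_addFaces (hA : A.faces ⊆ X.faces) (S : Finset (Finset V)) :
    IsIntermediate X A k (addFaces X A k S) where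
  le σ hσ := by
    rw [mem_skeleton] at hσ
    rw [mem_addFaces]
    refine ⟨hA hσ.1, ?_⟩
    rcases hσ.2 with h | h
    · by_cases hlt : (σ.card : ℤ) ≤ k
      · exact Or.inl (Or.inl hlt)
      · exact Or.inr ⟨by omega, Or.inl hσ.1⟩
    · exact Or.inl (Or.inr h)
  ge σ hσ := by
    rw [mem_addFaces] at hσ
    rw [mem_skeleton]
    refine ⟨hσ.1, ?_⟩
    rcases hσ.2 with (h | h) | h
    · exact Or.inl (by omega)
    · exact Or.inr h
    · exact Or.inl h.1.le
  skeleton_eq := by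
    ext σ
    rw [mem_skeleton, mem_skeleton, mem_addFaces, sub_add_cancel]
    tauto

lemma relFaces_addFaces {S : Finset (Finset V)} (hS : S ⊆ relFaces X A k) :
    relFaces (addFaces X A k S) (skeleton A k) k = S := by
  ext σ
  rw [mem_relFaces, mem_skeleton, mem_addFaces]
  constructor
  · rintro ⟨⟨⟨-, (h | rfl) | h⟩, h2⟩, hc⟩
    · omega
    · exact absurd ⟨A.empty_mem, Or.inr rfl⟩ h2
    · exact h.2.resolve_left fun h3 => h2 ⟨h3, Or.inl hc.le⟩
  · intro hσ
    obtain ⟨⟨h1, h2⟩, hc⟩ := mem_relFaces.mp (hS hσ)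
    exact ⟨⟨⟨h1, Or.inr ⟨hc, Or.inr hσ⟩⟩, fun h => h2 h.1⟩, hc⟩

lemma IsIntermediate.eq_addFaces (h : IsIntermediate X A k Y) :
    Y = addFaces X A k (relFaces Y (skeleton A k) k) := by
  ext σ
  rw [mem_addFaces]
  by_cases hσ : (σ.card : ℤ) ≤ k ∨ σ = ∅
  · rw [h.mem_iff hσ]
    tauto
  · rw [mem_relFaces, mem_skeleton]
    constructor
    · intro hY
      obtain ⟨h1, h2⟩ := mem_skeleton.mp (h.ge hY)
      have hc : (σ.card : ℤ) = k + 1 := by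
        push Not at hσ
        have := h2.resolve_right (by simpa [Finset.nonempty_iff_ne_empty] using hσ.2)
        omega
      tauto
    · rintro ⟨-, h2⟩
      obtain ⟨hc, h3 | h3⟩ := h2.resolve_left hσ
      · exact h.le (mem_skeleton.mpr ⟨h3, Or.inl hc.le⟩)
      · exact h3.1.1

lemma bijOn_isSpanning (hA : A.faces ⊆ X.faces) :
    Set.BijOn (fun Y => relFaces Y (skeleton A k) k) {Y | IsSpanning X A k Y}
      (colBases (incidenceMatrix V) (relFaces X A (k - 1)) (relFaces X A k) :
        Finset (Finset (Finset V))) := by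
  refine ⟨fun Y hY => (mem_colBases _).mpr (IsSpanning.isColBasis hA hY), ?_, ?_⟩
  · intro Y hY Z hZ h
    rw [IsIntermediate.eq_addFaces (IsSpanning.isIntermediate hY),
      IsIntermediate.eq_addFaces (IsSpanning.isIntermediate hZ)]
    exact congrArg _ h
  · intro S hS
    have hS' : IsColBasis _ _ _ S := (mem_colBases _).mp hS
    have h := relFaces_addFaces hS'.subset
    refine ⟨addFaces X A k S, ?_, h⟩
    rw [Set.mem_ofPred_eq, (isIntermediate_addFaces hA S).isSpanning_iff hA, h]
    exact hS'

lemma finsum_isSpanning (hA : A.faces ⊆ X.faces) {M : Type*} [AddCommMonoid M] (f : Cx V → M)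
    (g : Finset (Finset V) → M)
    (hfg : ∀ Y, IsSpanning X A k Y → f Y = g (relFaces Y (skeleton A k) k)) :
    ∑ᶠ Y ∈ {Y | IsSpanning X A k Y}, f Y =
      ∑ S ∈ colBases (incidenceMatrix V) (relFaces X A (k - 1)) (relFaces X A k), g S := by
  rw [← finsum_mem_coe_finset]
  exact finsum_mem_eq_of_bijOn _ (bijOn_isSpanning hA) hfg

lemma forests_nonempty (hA : A.faces ⊆ X.faces) : (forests X A k).Nonempty := by
  obtain ⟨S, hS⟩ := exists_isColBasis (incidenceMatrix V) (relFaces X A (k - 1)) (relFaces X A k)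
  obtain ⟨Y, hY, -⟩ := (bijOn_isSpanning hA).surjOn ((mem_colBases _).mpr hS)
  rw [forests_eq hA]
  exact ⟨Y, hY⟩

lemma trees_nonempty_iff (hA : A.faces ⊆ X.faces) :
    (trees X A k).Nonempty ↔ betti X A (k - 1) = 0 := by
  refine ⟨fun ⟨Y, hY⟩ => betti_eq_zero_of_mem_trees hA hY, fun h => ?_⟩
  rw [trees_eq_forests h]
  exact forests_nonempty hA

end Intermediate

section Weights

variable {X A Y : Cx V} {k : ℤ}

lemma IsSpanning.card_homology (h : IsSpanning X A k Y) :
    Nat.card (Homology ℤ Y (skeleton A k) (k - 1)) =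
      (blockRange (incidenceMatrix V) (relFaces X A (k - 1))
        (relFaces Y (skeleton A k) k)).toAddSubgroup.relIndex
      (blockKer (incidenceMatrix V) (relFaces X A (k - 2)) (relFaces X A (k - 1))).toAddSubgroup := by
  rw [RelTree.card_homology Y (skeleton A k) (i := k - 2) (l := k) (by omega) (by omega),
    h.isIntermediate.relFaces_eq_of_lt (sub_one_lt k),
    h.isIntermediate.relFaces_eq_of_lt (by omega : k - 2 < k)]

lemma IsSpanning.freeQuotientCard_homology (hA : A.faces ⊆ X.faces) (h : IsSpanning X A k Y) :
    freeQuotientCard (Homology ℤ Y (skeleton A k) (k - 1)) (betti X A (k - 1)) =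
      (blockRange (incidenceMatrix V) (relFaces X A (k - 1))
        (relFaces Y (skeleton A k) k)).toAddSubgroup.relIndex
      (saturation (blockRange (incidenceMatrix V) (relFaces X A (k - 1))
        (relFaces Y (skeleton A k) k))).toAddSubgroup := by
  rw [← h.betti_eq hA,
    RelTree.freeQuotientCard_homology Y (skeleton A k) (l := k) (by omega),
    h.isIntermediate.relFaces_eq_of_lt (sub_one_lt k)]

lemma upDownLaplacian_eq (X A : Cx V) {j l : ℤ} (hl : l = j + 1) :
    upDownLaplacian X A j =
      block ((incidenceMatrix V).map (Int.castRingHom ℝ)) (relFaces X A j) (relFaces X A l) *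
        (block ((incidenceMatrix V).map (Int.castRingHom ℝ)) (relFaces X A j)
          (relFaces X A l))ᵀ := by
  subst hl
  rfl

lemma gramDet_eq_of_subset {P T T' : Finset (Finset V)} (F : Matrix (Finset V) (Finset V) ℤ)
    (hT : T ⊆ T') (h : ∀ η ∈ P, ∀ σ ∈ T', σ ∉ T → F η σ = 0) : gramDet F P T' = gramDet F P T := by
  rw [gramDet, gramDet]
  congr 1
  ext η θ
  rw [mul_apply, mul_apply]
  have := Finset.sum_subset hT (f := fun σ => F η σ * F θ σ)
    fun σ hσ hσ' => by rw [h η η.2 σ hσ hσ', zero_mul]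
  rw [← Finset.sum_coe_sort T, ← Finset.sum_coe_sort T'] at this
  exact this.symm

lemma IsSpanning.relFaces_eq_sdiff (h : IsSpanning X A k Y) :
    relFaces X Y k = relFaces X A k \ relFaces Y (skeleton A k) k := by
  ext σ
  rw [Finset.mem_sdiff, mem_relFaces, mem_relFaces, mem_relFaces, mem_skeleton]
  constructor
  · rintro ⟨⟨h1, h2⟩, hc⟩
    exact ⟨⟨⟨h1, fun h3 => h2 (h.le (mem_skeleton.mpr ⟨h3, Or.inl hc.le⟩))⟩, hc⟩,
      fun h3 => h2 h3.1.1⟩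
  · rintro ⟨⟨⟨h1, h2⟩, hc⟩, h3⟩
    exact ⟨⟨h1, fun h4 => h3 ⟨⟨h4, fun h5 => h2 h5.1⟩, hc⟩⟩, hc⟩

lemma IsSpanning.gramDet_relFaces (h : IsSpanning X A k Y) :
    gramDet (incidenceMatrix V) (relFaces X Y k) (relFaces X Y (k + 1)) =
      gramDet (incidenceMatrix V) (relFaces X A k \ relFaces Y (skeleton A k) k)
        (relFaces X A (k + 1)) := by
  rw [h.relFaces_eq_sdiff]
  refine gramDet_eq_of_subset _ ?_ ?_
  · intro σ hσ
    rw [mem_relFaces] at hσ ⊢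
    obtain ⟨⟨h1, h2⟩, hc⟩ := hσ
    refine ⟨⟨h1, fun h3 => ?_⟩, hc⟩
    rcases (mem_skeleton.mp (h.ge h3)).2 with h4 | rfl
    · omega
    · exact h2 A.empty_mem
  · intro η hη σ hσ hσ'
    by_contra h0
    obtain ⟨v, -, hv⟩ := exists_of_incidence_ne_zero h0
    rw [mem_relFaces] at hσ hσ'
    have hσA : σ ∈ A.faces := by
      by_contra h1
      exact hσ' ⟨⟨hσ.1.1, h1⟩, hσ.2⟩
    refine (mem_relFaces.mp (Finset.mem_sdiff.mp hη).1).1.2 ?_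
    rw [← hv]
    exact A.down_closed σ hσA _ (Finset.erase_subset _ _)

end Weights

end Complexes

section MatrixTree

open Matrix

variable {V : Type*} [LinearOrder V] {X A : Cx V} {k : ℤ}

lemma finrank_add_finrank_of_betti_eq_zero (hb : betti X A (k - 1) = 0) :
    Module.finrank ℤ (blockRange (incidenceMatrix V) (relFaces X A (k - 1)) (relFaces X A k)) +
      Module.finrank ℤ (blockRange (incidenceMatrix V) (relFaces X A (k - 2))
        (relFaces X A (k - 1))) = (relFaces X A (k - 1)).card := by
  have h := betti_add_finrank X A (i := k - 2) (j := k - 1) (l := k) (by omega) (by omega)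
  omega

lemma finsum_trees (hA : A.faces ⊆ X.faces) (hb : betti X A (k - 1) = 0) :
    ∑ᶠ Υ ∈ trees X A k, (Nat.card (Homology ℤ Υ (skeleton A k) (k - 1)) : ℝ) ^ 2 =
      ((∑ S ∈ colBases (incidenceMatrix V) (relFaces X A (k - 1)) (relFaces X A k),
        ((blockRange (incidenceMatrix V) (relFaces X A (k - 1)) S).toAddSubgroup.relIndex
          (blockKer (incidenceMatrix V) (relFaces X A (k - 2))
            (relFaces X A (k - 1))).toAddSubgroup : ℤ) ^ 2 : ℤ) : ℝ) := by
  push_cast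
  rw [trees_eq_forests hb, forests_eq hA]
  exact finsum_isSpanning hA _ _ fun Y hY => by rw [hY.card_homology]

lemma finsum_forests (hA : A.faces ⊆ X.faces) (c : ℝ) :
    ∑ᶠ Γ ∈ forests X A k, (freeQuotientCard (Homology ℤ Γ (skeleton A k) (k - 1))
        (betti X A (k - 1)) : ℝ) ^ 2 / c =
      ((∑ U ∈ colBases (incidenceMatrix V) (relFaces X A (k - 1)) (relFaces X A k),
        ((blockRange (incidenceMatrix V) (relFaces X A (k - 1)) U).toAddSubgroup.relIndex
          (saturation (blockRange (incidenceMatrix V)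
            (relFaces X A (k - 1)) U)).toAddSubgroup : ℤ) ^ 2 : ℤ) : ℝ) / c := by
  push_cast
  rw [forests_eq hA, Finset.sum_div]
  exact finsum_isSpanning hA _ _ fun Y hY => by rw [hY.freeQuotientCard_homology hA]

lemma freeQuotientCard_homology_ne_zero (X A : Cx V) (j : ℤ) :
    freeQuotientCard (Homology ℤ X A j) (betti X A j) ≠ 0 := by
  rw [freeQuotientCard_homology X A rfl]
  exact relIndex_ne_zero_of_le_saturation le_rfl

lemma sum_colBases_sq_pos {ι : Type*} [DecidableEq ι] (F : Matrix ι ι ℤ) (P T : Finset ι)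
    (f : Finset ι → ℕ) (hf : ∀ S, IsColBasis F P T S → f S ≠ 0) :
    0 < ∑ S ∈ colBases F P T, (f S : ℤ) ^ 2 := by
  obtain ⟨S, hS⟩ := exists_isColBasis F P T
  refine Finset.sum_pos (fun S hS => ?_) ⟨S, (mem_colBases F).mpr hS⟩
  have := hf S ((mem_colBases F).mp hS)
  positivity

/-- The weighted count of trees in terms of the reduced Laplacian of a forest. -/
theorem finsum_trees_eq_det (hA : A.faces ⊆ X.faces) (hb : betti X A (k - 1) = 0) {Γ : Cx V}
    (hΓ : Γ ∈ forests X A (k - 1)) :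
    ∑ᶠ Υ ∈ trees X A k, (Nat.card (Homology ℤ Υ (skeleton A k) (k - 1)) : ℝ) ^ 2 =
      (freeQuotientCard (Homology ℤ X A (k - 2)) (betti X A (k - 2)) : ℝ) ^ 2 /
        (freeQuotientCard (Homology ℤ Γ (skeleton A (k - 1)) (k - 2)) (betti X A (k - 2)) : ℝ) ^ 2 *
      (upDownLaplacian X Γ (k - 1)).det := by
  have hk : k - 1 - 1 = k - 2 := by omega
  rw [forests_eq hA, Set.mem_ofPred_eq] at hΓ
  have hU := hΓ.isColBasis hA
  have hΓne : freeQuotientCard (Homology ℤ Γ (skeleton A (k - 1)) (k - 2)) (betti X A (k - 2)) ≠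
      0 := by
    rw [← hk, ← hΓ.betti_eq hA]
    exact freeQuotientCard_homology_ne_zero _ _ _
  have hΓt := hΓ.freeQuotientCard_homology hA
  rw [hk] at hU hΓt
  have hdet : (upDownLaplacian X Γ (k - 1)).det = Int.castRingHom ℝ
      (gramDet (incidenceMatrix V) (relFaces X Γ (k - 1)) (relFaces X Γ (k - 1 + 1))) := by
    rw [upDownLaplacian_eq X Γ (l := k - 1 + 1) rfl]
    exact gramDet_map _ _ _ _
  have hmain := gramDet_compl_mul_relIndex_sq
    (block_mul_block_relFaces X A (i := k - 2) (j := k - 1) (l := k) (by omega) (by omega))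
    (finrank_add_finrank_of_betti_eq_zero hb) hU
  rw [← hΓt, ← freeQuotientCard_homology X A (by omega)] at hmain
  rw [hdet, hΓ.gramDet_relFaces, sub_add_cancel, finsum_trees hA hb, div_mul_eq_mul_div,
    eq_div_iff (by positivity), mul_comm (_ ^ 2) (Int.castRingHom ℝ _),
    eq_intCast]
  exact_mod_cast hmain.symm

/-- The product of the nonzero eigenvalues of the up-down Laplacian in terms of weighted counts of
trees and forests. -/
theorem nonzeroEigenvalueProd_upDownLaplacian (hA : A.faces ⊆ X.faces)
    (hb : betti X A (k - 1) = 0) :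
    nonzeroEigenvalueProd (upDownLaplacian X A (k - 1)) =
      (∑ᶠ Υ ∈ trees X A k, (Nat.card (Homology ℤ Υ (skeleton A k) (k - 1)) : ℝ) ^ 2) *
      ∑ᶠ Γ ∈ forests X A (k - 1),
        (freeQuotientCard (Homology ℤ Γ (skeleton A (k - 1)) (k - 2)) (betti X A (k - 2)) : ℝ) ^ 2 /
          (freeQuotientCard (Homology ℤ X A (k - 2)) (betti X A (k - 2)) : ℝ) ^ 2 := by
  have hk : k - 1 - 1 = k - 2 := by omega
  have hF := block_mul_block_relFaces X A (i := k - 2) (j := k - 1) (l := k) (by omega) (by omega)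
  have hr := finrank_add_finrank_of_betti_eq_zero hb
  have hforests := finsum_forests (k := k - 1) hA
    ((freeQuotientCard (Homology ℤ X A (k - 2)) (betti X A (k - 2)) : ℝ) ^ 2)
  rw [hk] at hforests
  have hX := freeQuotientCard_homology_ne_zero X A (k - 2)
  have hmain := sum_gramDet_mul_relIndex_sq hF hr
  rw [← freeQuotientCard_homology X A (by omega)] at hmain
  have hminors : ∀ r : ℕ, ∑ S ∈ (Finset.univ : Finset (relFaces X A (k - 1))).powersetCard r,
      ((upDownLaplacian X A (k - 1)).submatrix (Subtype.val : S → _) Subtype.val).det =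
      ((∑ R ∈ (relFaces X A (k - 1)).powersetCard r,
        gramDet (incidenceMatrix V) R (relFaces X A k) : ℤ) : ℝ) := by
    intro r
    rw [upDownLaplacian_eq X A (l := k) (by omega), sum_minors_gram, Int.cast_sum]
    exact Finset.sum_congr rfl fun R _ => gramDet_map (Int.castRingHom ℝ) _ _ _
  have hpos := mul_pos
    (sum_colBases_sq_pos (incidenceMatrix V) (relFaces X A (k - 1)) (relFaces X A k) _
      fun S hS => relIndex_ne_zero_of_le_saturation (blockKer_le_saturation hF hr hS))
    (sum_colBases_sq_pos (incidenceMatrix V) (relFaces X A (k - 2)) (relFaces X A (k - 1)) _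
      fun U _ => relIndex_ne_zero_of_le_saturation
        (le_refl (saturation (blockRange (incidenceMatrix V) (relFaces X A (k - 2)) U))))
  have hM : (upDownLaplacian X A (k - 1)).IsHermitian := by
    rw [upDownLaplacian, ← conjTranspose_eq_transpose_of_trivial]
    exact isHermitian_mul_conjTranspose_self (boundaryMatrix ℝ X A (k - 1) (k - 1 + 1))
  rw [nonzeroEigenvalueProd_eq _ hM (Module.finrank ℤ (blockRange (incidenceMatrix V)
      (relFaces X A (k - 1)) (relFaces X A k))), hminors, hforests, finsum_trees hA hb,
    ← mul_div_assoc, eq_div_iff (by positivity)]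
  · exact_mod_cast hmain
  · rw [hminors, Int.cast_ne_zero]
    exact left_ne_zero_of_mul (hmain ▸ hpos.ne')
  · intro j hj
    rw [hminors, Int.cast_eq_zero]
    refine Finset.sum_eq_zero fun R hR => ?_
    obtain ⟨hRP, hRc⟩ := Finset.mem_powersetCard.mp hR
    exact gramDet_eq_zero_of_finrank_lt_card _ hRP (hRc ▸ hj)

end MatrixTree

end RelTree

open RelTree in
theorem theorem3p1 {V : Type*} [LinearOrder V] (X A : Cx V) (hA : A.faces ⊆ X.faces)
    (k : ℤ) (hk0 : 0 ≤ k) (hk : k ≤ dim X) :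
    (forests X A k).Nonempty ∧
    trees X A k ⊆ forests X A k ∧
    ((trees X A k).Nonempty ↔ betti X A (k - 1) = 0) ∧
    (betti X A (k - 1) = 0 →
      nonzeroEigenvalueProd (upDownLaplacian X A (k - 1)) =
          (∑ᶠ Υ ∈ trees X A k,
            (Nat.card (Homology ℤ Υ (skeleton A k) (k - 1)) : ℝ) ^ 2) *
          ∑ᶠ Γ ∈ forests X A (k - 1),
            (freeQuotientCard (Homology ℤ Γ (skeleton A (k - 1)) (k - 2))
                (betti X A (k - 2)) : ℝ) ^ 2 /
              (freeQuotientCard (Homology ℤ X A (k - 2)) (betti X A (k - 2)) : ℝ) ^ 2 ∧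
      ∀ Γ ∈ forests X A (k - 1),
        (∑ᶠ Υ ∈ trees X A k,
            (Nat.card (Homology ℤ Υ (skeleton A k) (k - 1)) : ℝ) ^ 2) =
          (freeQuotientCard (Homology ℤ X A (k - 2)) (betti X A (k - 2)) : ℝ) ^ 2 /
              (freeQuotientCard (Homology ℤ Γ (skeleton A (k - 1)) (k - 2))
                (betti X A (k - 2)) : ℝ) ^ 2 *
            (upDownLaplacian X Γ (k - 1)).det) :=
  ⟨forests_nonempty hA, trees_subset_forests hA, trees_nonempty_iff hA, fun hb =>
    ⟨nonzeroEigenvalueProd_upDownLaplacian hA hb, fun _ hΓ => finsum_trees_eq_det hA hb hΓ⟩⟩
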